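/- Graphs are finite, undirected and connected; loops and multiple edges are allowed, where a loop consists of two mutually opposite directed edges (no half-edges), and the degree of $x$ is the number of directed edges starting at $x$. The adjacency operator of a graph with vertex set $X$ and set $E$ of directed edges acts on functions $f:X\to\mathbb C$ by $(Af)(x)=\sum_{e\in E,\ t(e)=x}f(s(e))$, where $s(e)$ and $t(e)$ are the source and the target of $e$. A $d$-regular graph is Ramanujan if every eigenvalue $\lambda$ of $A$ satisfies $|\lambda|=d$ or $|\lambda|\le 2\sqrt{d-1}$. For $S\subseteq X$ let $N(S)$ be the set of all vertices (including those in $S$) that are joined by an edge to a vertex of $S$. (1) There is an absolute constant $C>0$ such that for every $d$-regular Ramanujan graph $X$, every integer $l\ge 1$ and every $S\subseteq X$ with $|S|(d-1)^l\le |X|$, $$|N(S)|\ \ge\ \frac d2\,|S|\left(1-C\,\frac{\ln(l+2)}{l}\right).$$ (2) For every $\epsilon>0$ there is $\delta>0$ such that for every $d$ there is $\eta>0$ with the following property. If $X$ is a $d$-regular Ramanujan graph and $S\subseteq X$ satisfies $|S|\le\eta|X|$ and $|N(S)|\le\frac d2|S|(1+\delta)$, then all but at most $\epsilon|N(S)|$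 of the vertices $x\in N(S)$ are joined to $S$ by exactly two edges (the number of directed edges $e$ with $s(e)\in S$, $t(e)=x$ is $2$). In particular, if $X$ has no loops and no multiple edges, then all but at most $\epsilon|N(S)|$ of the vertices of $N(S)$ have exactly two neighbours in $S$. -/

import Mathlib

universe u v


/-- An undirected multigraph with vertex set `V`, described by its directed edges `E`: every
directed edge has a source, a target and an opposite edge different from itself. Multiple edges
and loops are allowed (a loop consists of two mutually opposite directed edges), half-edges are
not. -/
structure UMultigraph (V : Type*) (E : Type*) where
  src : E → V
  tgt : E → V
  inv : E → E
  inv_inv : ∀ e, inv (inv e) = e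
  src_inv : ∀ e, src (inv e) = tgt e
  inv_ne : ∀ e, inv e ≠ e

namespace UMultigraph

/-- `x` and `y` are joined by an edge. -/
def Adj {V E : Type*} (G : UMultigraph V E) (x y : V) : Prop :=
  ∃ e, G.src e = x ∧ G.tgt e = y

/-- The graph is non-empty and any two vertices are joined by a path. -/
def IsConnected {V E : Type*} (G : UMultigraph V E) : Prop :=
  Nonempty V ∧ ∀ x y : V, Relation.ReflTransGen G.Adj x y

/-- There are no multiple edges and no loops: a directed edge is determined by its two ends
(the two directed edges of a loop have the same ends, so loops are excluded). -/
def IsSimple {V E : Type*} (G : UMultigraph V E) : Prop :=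
  ∀ e e' : E, G.src e = G.src e' → G.tgt e = G.tgt e' → e = e'

/-- The number of directed edges that start at `x`. -/
def degree {V E : Type*} [Fintype E] [DecidableEq V] (G : UMultigraph V E) (x : V) : ℕ :=
  (Finset.univ.filter fun e => G.src e = x).card

def IsRegular {V E : Type*} [Fintype E] [DecidableEq V] (G : UMultigraph V E) (d : ℕ) : Prop :=
  ∀ x, G.degree x = d

/-- The adjacency operator on complex functions, `(A f)(x) = ∑_{e : t(e) = x} f(s(e))`. -/
def adjOp {V E : Type*} [Fintype E] [DecidableEq V] (G : UMultigraph V E) :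
    (V → ℂ) →ₗ[ℂ] (V → ℂ) where
  toFun f x := ∑ e ∈ Finset.univ.filter (fun e => G.tgt e = x), f (G.src e)
  map_add' f g := by
    funext x
    simp [Finset.sum_add_distrib]
  map_smul' c f := by
    funext x
    simp [Finset.mul_sum]

/-- A `d`-regular Ramanujan graph: connected, `d`-regular, and every eigenvalue of the adjacency
operator has absolute value `d` or at most `2 √(d - 1)`. -/
def IsRamanujan {V E : Type*} [Fintype E] [DecidableEq V] (G : UMultigraph V E) (d : ℕ) : Prop :=
  G.IsConnected ∧ G.IsRegular d ∧
    ∀ μ : ℂ, Module.End.HasEigenvalue G.adjOp μ →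
      ‖μ‖ = (d : ℝ) ∨ ‖μ‖ ≤ 2 * Real.sqrt ((d : ℝ) - 1)

/-- `N(S)`: all targets of edges that start in `S` (these may lie in `S` themselves). -/
def neighbors {V E : Type*} [Fintype E] [DecidableEq V] (G : UMultigraph V E) (S : Finset V) :
    Finset V :=
  (Finset.univ.filter fun e => G.src e ∈ S).image G.tgt

/-- The number of edges from `S` to `x`, i.e. the number of neighbours of `x` in `S` counted with
the multiplicity of the joining edges. -/
def edgesFrom {V E : Type*} [Fintype E] [DecidableEq V] (G : UMultigraph V E) (S : Finset V)
    (x : V) : ℕ :=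
  (Finset.univ.filter fun e => G.src e ∈ S ∧ G.tgt e = x).card

open Classical in
/-- The number of vertices of `S` that are adjacent to `x`. -/
noncomputable def neighborsIn {V E : Type*} (G : UMultigraph V E) (S : Finset V) (x : V) : ℕ :=
  (S.filter fun y => G.Adj y x).card

end UMultigraph

/-! Write `q = d - 1`. The proof counts non-backtracking walks with `2 * l` edges from `S` to `S` in
two ways. Upper bound (`IsRamanujan.sum_sphereSum_le`): on an eigenfunction with `|μ| ≤ 2 * √q` the
walk operator acts by a scalar of size `O(l * q ^ l)`, and the eigenvalues `± d` add at most `O(q ^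
(2 * l) * #S ^ 2 / #V)`. When `#S * q ^ l ≤ #V` the total is at most `(3 * l + 5) * q ^ l * #S`.
Lower bound (`sum_log_altCount`): consider only walks alternating between `S` and `T = N(S)`. The
uniform measure on the edges is stationary under non-backtracking steps, so Jensen's inequality
makes every step at a vertex of degree `x` contribute `log (x - 1)`, averaged over edges. Steps at
`S` contribute about `log q`, which the upper bound cancels. Steps at `T` therefore contribute only
`O(log l / l)` on average, so the mean degree on `T` is at most about `2`: this is `#T ≥ d / 2 * #S`
up to the error. Stability: `x * log (x - 1)` lies above its tangent `2 * (x - 2)` at `2`, with a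
fixed gap at the integers `x ≥ 3`, so degrees other than `2` are rare. Jensen's inequality needs all
degrees to be at least `2`; `exists_core` passes to subsets where this holds and charges the loss to
the same budget. -/

open Finset

set_option linter.unusedSectionVars false

/-! ### Polynomials of non-backtracking walks -/

/-- The polynomials which count non-backtracking walks in a `(q + 1)`-regular graph. -/
noncomputable def nbPoly (q x : ℝ) : ℕ → ℝ
  -- This value, rather than `1`, lets the single recurrence also give the polynomial `x ^ 2 - (q +
  -- 1)` of walks of length two.
  | 0 => (q + 1) / q
  | 1 => x
  | n + 2 => x * nbPoly q x (n + 1) - q * nbPoly q x n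

/-- A quadratic form invariant under the linear recurrence up to its determinant `q`. -/
lemma nbPoly_invariant {q : ℝ} (hq : 0 < q) (x : ℝ) (n : ℕ) :
    nbPoly q x (n + 1) ^ 2 - x * nbPoly q x n * nbPoly q x (n + 1) + q * nbPoly q x n ^ 2
      = q ^ n * (((q + 1) ^ 2 - x ^ 2) / q) := by
  induction n with
  | zero =>
    simp only [nbPoly]
    field_simp
    ring
  | succ n ih =>
    have h : nbPoly q x (n + 1 + 1) = x * nbPoly q x (n + 1) - q * nbPoly q x n := rfl
    rw [h, pow_succ' q n, mul_assoc q, ← ih]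
    ring

lemma abs_nbPoly_le {q : ℝ} (hq : 0 < q) {x : ℝ} (hx : |x| ≤ 2 * √q) (n : ℕ) :
    |nbPoly q x n| ≤ (q + 1) / q * (n + 1) * √q ^ n := by
  have hs : 0 < √q := Real.sqrt_pos.2 hq
  have hsq : √q ^ 2 = q := Real.sq_sqrt hq.le
  induction n with
  | zero =>
    simp only [nbPoly]
    rw [abs_of_pos (by positivity)]
    simp
  | succ n ih =>
    -- Complete the square in the invariant: the remaining term `(q - x ^ 2 / 4) * nbPoly q x n ^ 2`
    -- is nonnegative for `|x| ≤ 2 * √q`. Each induction step then adds one unit to the linear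
    -- factor.
    have key : |nbPoly q x (n + 1) - x / 2 * nbPoly q x n| ≤ (q + 1) / q * √q ^ (n + 1) := by
      apply abs_le_of_sq_le_sq _ (by positivity)
      have h1 := nbPoly_invariant hq x n
      have h2 : ((q + 1) / q * √q ^ (n + 1)) ^ 2 = q ^ n * ((q + 1) ^ 2 / q) := by
        rw [mul_pow, ← pow_mul, mul_comm (n + 1) 2, pow_mul, hsq]
        field_simp
        ring
      have h3 : q ^ n * (((q + 1) ^ 2 - x ^ 2) / q) ≤ q ^ n * ((q + 1) ^ 2 / q) := by
        gcongr
        nlinarith [sq_nonneg x]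
      have h4 : x ^ 2 ≤ 4 * q := by
        have := sq_le_sq' (by linarith [neg_abs_le |x|, abs_nonneg x]) hx
        rw [sq_abs] at this
        nlinarith
      nlinarith [mul_le_mul_of_nonneg_right h4 (sq_nonneg (nbPoly q x n))]
    have h5 : |x / 2 * nbPoly q x n| ≤ √q * ((q + 1) / q * (n + 1) * √q ^ n) := by
      rw [abs_mul, abs_div, abs_two]
      exact mul_le_mul (by linarith) ih (abs_nonneg _) hs.le
    have h6 := abs_add_le (nbPoly q x (n + 1) - x / 2 * nbPoly q x n) (x / 2 * nbPoly q x n)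
    rw [sub_add_cancel] at h6
    calc _ ≤ _ := h6
      _ ≤ _ := add_le_add key h5
      _ = _ := by push_cast; ring

lemma nbPoly_extremal {q : ℝ} (hq : 0 < q) {σ : ℝ} (hσ : σ ^ 2 = 1) (n : ℕ) :
    nbPoly q (σ * (q + 1)) n = σ ^ n * ((q + 1) / q * q ^ n) := by
  induction n using Nat.twoStepInduction with
  | zero => simp [nbPoly]
  | one => simp only [nbPoly]; field_simp
  | more n h0 h1 =>
    rw [nbPoly, h0, h1, pow_succ σ (n + 1), pow_succ σ n]
    have : σ ^ n = σ ^ n * σ ^ 2 := by rw [hσ, mul_one]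
    field_simp
    linear_combination -q * q ^ n * this

/-! ### Non-backtracking walks and their recurrence -/

namespace UMultigraph

variable {V : Type u} {E : Type v} [Fintype V] [Fintype E] [DecidableEq V] [DecidableEq E]

lemma tgt_inv (G : UMultigraph V E) (e : E) : G.tgt (G.inv e) = G.src e := by
  rw [← G.src_inv, G.inv_inv]

/-- The involution which reverses the directed edges. -/
def invEquiv (G : UMultigraph V E) : E ≃ E := ⟨G.inv, G.inv, G.inv_inv, G.inv_inv⟩

lemma sum_inv (G : UMultigraph V E) (h : E → ℝ) : ∑ e, h (G.inv e) = ∑ e, h e :=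
  Equiv.sum_comp G.invEquiv h

lemma sum_src (G : UMultigraph V E) {d : ℕ} (hd : G.IsRegular d) (h : V → ℝ) :
    ∑ e, h (G.src e) = d * ∑ x, h x := by
  rw [← Finset.sum_fiberwise (s := univ) (g := G.src), mul_sum]
  refine sum_congr rfl fun x _ => ?_
  rw [sum_congr rfl (g := fun _ => h x) (by intro e he; rw [(mem_filter.1 he).2]), sum_const,
    nsmul_eq_mul]
  congr 2
  exact hd x

lemma sum_tgt (G : UMultigraph V E) {d : ℕ} (hd : G.IsRegular d) (h : V → ℝ) :
    ∑ e, h (G.tgt e) = d * ∑ x, h x := by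
  rw [← G.sum_src hd, ← G.sum_inv]
  simp_rw [G.tgt_inv]

lemma eq_of_forall_edge {G : UMultigraph V E} (hG : G.IsConnected) {h : V → ℝ}
    (hh : ∀ e, h (G.tgt e) = h (G.src e)) (x y : V) : h x = h y := by
  induction hG.2 x y with
  | refl => rfl
  | tail _ hbc ih =>
    obtain ⟨e, rfl, rfl⟩ := hbc
    rw [ih, hh]

/-- `walkCount f n e` is the sum of the values of `f` at the ends of the non-backtracking walks
that consist of `e` followed by `n` further edges. -/
def walkCount (G : UMultigraph V E) (f : V → ℝ) : ℕ → E → ℝ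
  | 0, e => f (G.tgt e)
  | n + 1, e => ∑ e' with G.src e' = G.tgt e ∧ e' ≠ G.inv e, G.walkCount f n e'

/-- The sum of the values of `f` at the ends of the non-backtracking walks with `n + 1` edges
that start at `x`. -/
def sphereSum (G : UMultigraph V E) (f : V → ℝ) (n : ℕ) (x : V) : ℝ :=
  ∑ e with G.src e = x, G.walkCount f n e

lemma walkCount_nonneg (G : UMultigraph V E) {f : V → ℝ} (hf : ∀ x, 0 ≤ f x) (n : ℕ) (e : E) :
    0 ≤ G.walkCount f n e := by
  induction n generalizing e with
  | zero => exact hf _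
  | succ n ih => exact sum_nonneg fun e' _ => ih e'

/-- Allow all continuations from the end of `e` and subtract the one that goes straight back. -/
lemma walkCount_succ (G : UMultigraph V E) (f : V → ℝ) (n : ℕ) (e : E) :
    G.walkCount f (n + 1) e = G.sphereSum f n (G.tgt e) - G.walkCount f n (G.inv e) := by
  have h : (univ.filter fun e' => G.src e' = G.tgt e ∧ e' ≠ G.inv e)
      = (univ.filter fun e' => G.src e' = G.tgt e).erase (G.inv e) := by
    ext e'
    simp [and_comm]
  rw [walkCount, sphereSum, h, eq_sub_iff_add_eq, sum_erase_add]
  simp [G.src_inv]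

lemma sphereSum_one (G : UMultigraph V E) {d : ℕ} (hd : G.IsRegular d) (f : V → ℝ) (x : V) :
    G.sphereSum f 1 x = (∑ e with G.src e = x, G.sphereSum f 0 (G.tgt e)) - d * f x := by
  have h : ∑ e with G.src e = x, f (G.src e) = d * f x := by
    rw [sum_congr rfl (g := fun _ => f x) (by intro e he; rw [(mem_filter.1 he).2]), sum_const,
      nsmul_eq_mul]
    congr 2
    exact hd x
  rw [sphereSum, ← h, ← sum_sub_distrib]
  refine sum_congr rfl fun e _ => ?_
  rw [walkCount_succ, walkCount, G.tgt_inv]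

lemma sphereSum_add_two (G : UMultigraph V E) {d : ℕ} (hd : G.IsRegular d) (f : V → ℝ) (n : ℕ)
    (x : V) :
    G.sphereSum f (n + 2) x = (∑ e with G.src e = x, G.sphereSum f (n + 1) (G.tgt e))
      - ((d : ℝ) - 1) * G.sphereSum f n x := by
  have h : ∑ e with G.src e = x, G.sphereSum f n (G.src e) = d * G.sphereSum f n x := by
    rw [sum_congr rfl (g := fun _ => G.sphereSum f n x)
      (by intro e he; rw [(mem_filter.1 he).2]), sum_const, nsmul_eq_mul]
    congr 2
    exact hd x
  have h2 : ∀ e, G.walkCount f (n + 2) e = G.sphereSum f (n + 1) (G.tgt e)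
      - (G.sphereSum f n (G.src e) - G.walkCount f n e) := by
    intro e
    rw [walkCount_succ, walkCount_succ, G.tgt_inv, G.inv_inv]
  rw [sphereSum]
  simp_rw [h2, sum_sub_distrib, h]
  rw [← sphereSum]
  ring

/-- An orthonormal eigenbasis of the adjacency operator on real functions. -/
lemma exists_eigenbasis (G : UMultigraph V E) :
    ∃ (b : V → V → ℝ) (μ : V → ℝ),
      (∀ i x, ∑ e with G.src e = x, b i (G.tgt e) = μ i * b i x) ∧
      (∀ i j, ∑ x, b i x * b j x = if i = j then 1 else 0) ∧
      (∀ f g : V → ℝ, ∑ x, f x * g x = ∑ i, (∑ x, b i x * f x) * ∑ x, b i x * g x) := by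
  let M : Matrix V V ℝ :=
    Matrix.of fun x y => ((univ.filter fun e => G.src e = x ∧ G.tgt e = y).card : ℝ)
  have hM : M.IsHermitian := by
    ext x y
    simp only [M, Matrix.conjTranspose_apply, Matrix.of_apply, star_trivial, Nat.cast_inj]
    refine card_bij (fun e _ => G.inv e) ?_ ?_ ?_
    · intro e he
      simp only [mem_filter, mem_univ, true_and] at he ⊢
      rw [G.src_inv, G.tgt_inv]
      exact he.symm
    · intro e _ e' _ h
      exact G.invEquiv.injective h
    · intro e he
      simp only [mem_filter, mem_univ, true_and] at he
      refine ⟨G.inv e, ?_, G.inv_inv e⟩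
      simp only [mem_filter, mem_univ, true_and]
      rw [G.src_inv, G.tgt_inv]
      exact he.symm
  have hMv : ∀ (f : V → ℝ) x, (M.mulVec f) x = ∑ e with G.src e = x, f (G.tgt e) := by
    intro f x
    rw [← Finset.sum_fiberwise (s := univ.filter fun e => G.src e = x) (g := G.tgt)]
    simp only [Matrix.mulVec, dotProduct, M, Matrix.of_apply]
    refine sum_congr rfl fun y _ => ?_
    rw [filter_filter, sum_congr rfl (g := fun _ => f y)
      (by intro e he; rw [(mem_filter.1 he).2.2]), sum_const, nsmul_eq_mul]
  have hin : ∀ f g : EuclideanSpace ℝ V, inner ℝ f g = ∑ x, f x * g x := by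
    intro f g
    simp [PiLp.inner_apply, mul_comm]
  refine ⟨fun i x => hM.eigenvectorBasis i x, hM.eigenvalues, ?_, ?_, ?_⟩
  · intro i x
    rw [← hMv (fun y => hM.eigenvectorBasis i y)]
    have := congrFun (hM.mulVec_eigenvectorBasis i) x
    simpa using this
  · intro i j
    rw [← hin]
    exact orthonormal_iff_ite.1 hM.eigenvectorBasis.orthonormal i j
  · intro f g
    have := hM.eigenvectorBasis.sum_inner_mul_inner (WithLp.toLp 2 f) (WithLp.toLp 2 g)
    simp_rw [hin] at this
    rw [← this]
    simp [mul_comm]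

end UMultigraph

/-! ### Spectral upper bound for walks from a set to itself -/

namespace UMultigraph

variable {V : Type u} {E : Type v} [Fintype V] [Fintype E] [DecidableEq V] [DecidableEq E]

lemma sum_mul_sum_tgt (G : UMultigraph V E) (f g : V → ℝ) :
    ∑ x, f x * ∑ e with G.src e = x, g (G.tgt e) = ∑ e, f (G.src e) * g (G.tgt e) := by
  rw [← Finset.sum_fiberwise (s := univ) (g := G.src)]
  refine sum_congr rfl fun x _ => ?_
  rw [mul_sum]
  exact sum_congr rfl fun e he => by rw [(mem_filter.1 he).2]

lemma sum_mul_sum_tgt_comm (G : UMultigraph V E) (f g : V → ℝ) :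
    ∑ x, f x * ∑ e with G.src e = x, g (G.tgt e)
      = ∑ x, (∑ e with G.src e = x, f (G.tgt e)) * g x := by
  simp_rw [mul_comm _ (g _)]
  rw [sum_mul_sum_tgt, sum_mul_sum_tgt, ← G.sum_inv]
  simp_rw [G.src_inv, G.tgt_inv, mul_comm]

/-- The coefficient of a non-backtracking average along an eigenfunction. -/
lemma sum_mul_sphereSum (G : UMultigraph V E) {d : ℕ} (hd : G.IsRegular d) {q : ℝ} (hq : q ≠ 0)
    (hdq : (d : ℝ) = q + 1) {b : V → ℝ} {μ : ℝ}
    (hb : ∀ x, ∑ e with G.src e = x, b (G.tgt e) = μ * b x) (f : V → ℝ) (n : ℕ) :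
    ∑ x, b x * G.sphereSum f n x = nbPoly q μ (n + 1) * ∑ x, b x * f x := by
  have hA : ∀ g : V → ℝ, ∑ x, b x * ∑ e with G.src e = x, g (G.tgt e) = μ * ∑ x, b x * g x := by
    intro g
    rw [sum_mul_sum_tgt_comm, mul_sum]
    exact sum_congr rfl fun x _ => by rw [hb, mul_assoc]
  induction n using Nat.twoStepInduction with
  | zero =>
    simp only [sphereSum, walkCount]
    rw [hA]
    rfl
  | one =>
    simp_rw [G.sphereSum_one hd, mul_sub, sum_sub_distrib]
    rw [hA (G.sphereSum f 0)]
    simp only [sphereSum, walkCount]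
    rw [hA, hdq]
    simp_rw [mul_left_comm (b _)]
    rw [← mul_sum]
    simp only [nbPoly]
    field_simp
  | more n h0 h1 =>
    simp_rw [G.sphereSum_add_two hd, mul_sub, sum_sub_distrib]
    rw [hA (G.sphereSum f (n + 1)), h1]
    simp_rw [mul_left_comm (b _)]
    rw [← mul_sum, h0, hdq, nbPoly.eq_3 q μ (n + 1)]
    ring

/-- Eigenfunctions with eigenvalue `± d` of a `d`-regular graph. -/
lemma extremal_eigenfunction (G : UMultigraph V E) {d : ℕ} (hd : G.IsRegular d) {b : V → ℝ}
    {σ : ℝ} (hσ : σ ^ 2 = 1)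
    (hb : ∀ x, ∑ e with G.src e = x, b (G.tgt e) = σ * d * b x) (e : E) :
    b (G.tgt e) = σ * b (G.src e) := by
  -- Equality case of Cauchy-Schwarz over the edges: the expanded sum of squares vanishes.
  have h : ∑ e, (b (G.tgt e) - σ * b (G.src e)) ^ 2 = 0 := by
    have h1 : ∑ e, b (G.src e) * b (G.tgt e) = σ * d * ∑ x, b x ^ 2 := by
      rw [← sum_mul_sum_tgt, mul_sum]
      exact sum_congr rfl fun x _ => by rw [hb]; ring
    have h2 := G.sum_src hd fun x => b x ^ 2
    have h3 := G.sum_tgt hd fun x => b x ^ 2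
    calc _ = ∑ e, (b (G.tgt e) ^ 2 + σ ^ 2 * b (G.src e) ^ 2
            - 2 * σ * (b (G.src e) * b (G.tgt e))) := sum_congr rfl fun e _ => by ring
      _ = 0 := by
        rw [sum_sub_distrib, sum_add_distrib, ← mul_sum, ← mul_sum, h1, h2, h3, hσ]
        linear_combination (-2 * d * ∑ x, b x ^ 2) * hσ
  rw [sum_eq_zero_iff_of_nonneg fun e _ => sq_nonneg _] at h
  exact sub_eq_zero.1 (pow_eq_zero_iff two_ne_zero |>.1 (h e (mem_univ e)))

lemma extremal_mul_eq {G : UMultigraph V E} (hG : G.IsConnected) {σ : ℝ} (hσ : σ ^ 2 = 1)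
    {b c : V → ℝ} (hb : ∀ e, b (G.tgt e) = σ * b (G.src e))
    (hc : ∀ e, c (G.tgt e) = σ * c (G.src e)) (x : V) :
    Fintype.card V * (b x * c x) = ∑ y, b y * c y := by
  have h := eq_of_forall_edge hG (h := fun y => b y * c y) fun e => by
    rw [hb, hc]
    linear_combination b (G.src e) * c (G.src e) * hσ
  rw [sum_congr rfl fun y _ => h y x, sum_const, nsmul_eq_mul, card_univ]

/-- The product of two such eigenfunctions is constant by connectedness. Orthogonality makes the
constant zero, while each of them has constant nonzero square. -/
lemma card_extremal_le_one {G : UMultigraph V E} (hG : G.IsConnected) {d : ℕ}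
    (hd : G.IsRegular d) {b : V → V → ℝ} {μ : V → ℝ}
    (hb : ∀ i x, ∑ e with G.src e = x, b i (G.tgt e) = μ i * b i x)
    (hon : ∀ i j, ∑ x, b i x * b j x = if i = j then 1 else 0) {σ : ℝ} (hσ : σ ^ 2 = 1) :
    (univ.filter fun i => μ i = σ * d).card ≤ 1 := by
  rw [card_le_one]
  intro i hi j hj
  by_contra hij
  have hi' := G.extremal_eigenfunction hd hσ (b := b i) fun x => by
    rw [hb, (mem_filter.1 hi).2]
  have hj' := G.extremal_eigenfunction hd hσ (b := b j) fun x => by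
    rw [hb, (mem_filter.1 hj).2]
  have h1 := extremal_mul_eq hG hσ hi' hi' i
  have h2 := extremal_mul_eq hG hσ hj' hj' i
  have h3 := extremal_mul_eq hG hσ hi' hj' i
  rw [hon] at h1 h2 h3
  simp only [if_true, if_neg hij] at h1 h2 h3
  have : (1 : ℝ) = 0 := by
    linear_combination (-1 : ℝ) * h2 - (Fintype.card V * (b j i * b j i)) * h1
      + (Fintype.card V * (b i i * b j i)) * h3
  norm_num at this

/-- Real eigenvalues of a Ramanujan graph. -/
lemma IsRamanujan.eigenvalue {G : UMultigraph V E} {d : ℕ} (hG : G.IsRamanujan d) {b : V → ℝ}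
    {μ : ℝ} (hb : ∀ x, ∑ e with G.src e = x, b (G.tgt e) = μ * b x) (h0 : ∃ x, b x ≠ 0) :
    |μ| = d ∨ |μ| ≤ 2 * √((d : ℝ) - 1) := by
  have h : Module.End.HasEigenvalue G.adjOp (μ : ℂ) := by
    apply Module.End.hasEigenvalue_of_hasEigenvector (x := fun x => (b x : ℂ))
    refine Module.End.hasEigenvector_iff.2 ⟨Module.End.mem_eigenspace_iff.2 ?_, ?_⟩
    · funext x
      have h1 : ∑ e with G.tgt e = x, b (G.src e) = μ * b x := by
        rw [← hb, sum_filter, ← G.sum_inv, sum_filter]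
        simp_rw [G.src_inv, G.tgt_inv]
      simp only [adjOp, LinearMap.coe_mk, AddHom.coe_mk, Pi.smul_apply, smul_eq_mul]
      exact_mod_cast h1
    · obtain ⟨x, hx⟩ := h0
      intro h
      exact hx (by simpa using congrFun h x)
  simpa using hG.2.2 μ h

/-- The number of non-backtracking walks between vertices of a set in a Ramanujan graph. -/
lemma IsRamanujan.sum_sphereSum_le {G : UMultigraph V E} {d : ℕ} (hG : G.IsRamanujan d) {q : ℝ}
    (hq : 0 < q) (hdq : (d : ℝ) = q + 1) (S : Finset V) (n : ℕ) :
    ∑ x ∈ S, G.sphereSum (fun x => if x ∈ S then 1 else 0) n x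
      ≤ (q + 1) / q * (n + 2) * √q ^ (n + 1) * #S
        + 2 * ((q + 1) / q * q ^ (n + 1) * ((#S : ℝ) ^ 2 / Fintype.card V)) := by
  obtain ⟨b, μ, hb, hon, hpars⟩ := G.exists_eigenbasis
  have hconn := hG.1
  have hd := hG.2.1
  have hV : (0 : ℝ) < Fintype.card V := by
    have := hconn.1
    exact_mod_cast Fintype.card_pos
  set f : V → ℝ := fun x => if x ∈ S then 1 else 0 with hf
  have hfS : ∀ g : V → ℝ, ∑ x, f x * g x = ∑ x ∈ S, g x := by
    intro g
    simp [hf]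
  have hfS' : ∀ g : V → ℝ, ∑ x, g x * f x = ∑ x ∈ S, g x := by
    intro g
    simp [hf]
  have hsum : ∑ i, (∑ x, b i x * f x) ^ 2 = #S := by
    have := hpars f f
    rw [hfS] at this
    simp only [sq]
    rw [← this]
    simp [hf]
  rw [← hfS, hpars]
  have hK0 : 0 ≤ (q + 1) / q * q ^ (n + 1) * ((#S : ℝ) ^ 2 / Fintype.card V) :=
    mul_nonneg (by positivity) (div_nonneg (sq_nonneg _) hV.le)
  set K : ℝ := (q + 1) / q * q ^ (n + 1) * ((#S : ℝ) ^ 2 / Fintype.card V) with hK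
  have hext : ∀ σ : ℝ, σ ^ 2 = 1 → ∀ i, μ i = σ * d →
      nbPoly q (μ i) (n + 1) * (∑ x, b i x * f x) ^ 2 ≤ K := by
    intro σ hσ i hi
    have hi' := G.extremal_eigenfunction hd hσ (b := b i) fun x => by rw [hb, hi]
    have h1 : ∀ x, b i x ^ 2 = 1 / Fintype.card V := by
      intro x
      have := extremal_mul_eq hconn hσ hi' hi' x
      rw [hon, if_pos rfl] at this
      rw [eq_div_iff hV.ne']
      linarith
    -- An extremal unit eigenfunction has square `1 / #V` everywhere, so Cauchy-Schwarz on `S`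
    -- bounds its coefficient.
    have h2 : (∑ x, b i x * f x) ^ 2 ≤ (#S : ℝ) ^ 2 / Fintype.card V := by
      rw [hfS']
      refine (sq_sum_le_card_mul_sum_sq).trans_eq ?_
      simp_rw [h1]
      rw [sum_const, nsmul_eq_mul]
      ring
    have h3 : nbPoly q (μ i) (n + 1) ≤ (q + 1) / q * q ^ (n + 1) := by
      rw [hi, hdq, nbPoly_extremal hq hσ]
      have : |σ ^ (n + 1)| = 1 := by
        rw [abs_pow, (pow_eq_one_iff_of_nonneg (abs_nonneg σ) two_ne_zero).1
          (by rw [sq_abs, hσ]), one_pow]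
      exact mul_le_of_le_one_left (by positivity) (le_of_abs_le this.le)
    exact (mul_le_mul_of_nonneg_right h3 (sq_nonneg _)).trans
      (mul_le_mul_of_nonneg_left h2 (by positivity))
  have hterm : ∀ i, (∑ x, b i x * f x) * ∑ x, b i x * G.sphereSum f n x
      ≤ (q + 1) / q * (n + 2) * √q ^ (n + 1) * (∑ x, b i x * f x) ^ 2
        + ((if μ i = 1 * d then K else 0) + if μ i = -1 * d then K else 0) := by
    intro i
    rw [G.sum_mul_sphereSum hd hq.ne' hdq (hb i)]
    have hr : (∑ x, b i x * f x) * (nbPoly q (μ i) (n + 1) * ∑ x, b i x * f x)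
        = nbPoly q (μ i) (n + 1) * (∑ x, b i x * f x) ^ 2 := by ring
    rw [hr]
    have h0 : 0 ≤ (q + 1) / q * (n + 2) * √q ^ (n + 1) * (∑ x, b i x * f x) ^ 2 := by positivity
    by_cases hp : μ i = 1 * d
    · have := hext 1 (by norm_num) i hp
      rw [if_pos hp]
      split_ifs
      all_goals linarith
    by_cases hm : μ i = -1 * d
    · have := hext (-1) (by norm_num) i hm
      rw [if_pos hm]
      split_ifs
      all_goals linarith
    rw [if_neg hp, if_neg hm]
    have hne : ∃ x, b i x ≠ 0 := by
      by_contra! h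
      have := hon i i
      simp [h] at this
    have hμ : |μ i| ≤ 2 * √q := by
      rcases hG.eigenvalue (hb i) hne with h | h
      · rcases eq_or_eq_neg_of_abs_eq h with h | h
        · exact absurd (by rw [h, one_mul]) hp
        · exact absurd (by rw [h, neg_one_mul]) hm
      · rwa [hdq, add_sub_cancel_right] at h
    have := (le_abs_self _).trans (abs_nbPoly_le hq hμ (n + 1))
    have h3 := mul_le_mul_of_nonneg_right this (sq_nonneg (∑ x, b i x * f x))
    push_cast at h3
    linear_combination h3
  refine (sum_le_sum fun i _ => hterm i).trans ?_
  rw [sum_add_distrib, ← mul_sum, hsum, sum_add_distrib, ← sum_filter, ← sum_filter, sum_const,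
    sum_const, nsmul_eq_mul, nsmul_eq_mul]
  have h1 : ((univ.filter fun i => μ i = 1 * d).card : ℝ) ≤ 1 := by
    exact_mod_cast card_extremal_le_one hconn hd hb hon (σ := 1) (by norm_num)
  have h2 : ((univ.filter fun i => μ i = -1 * d).card : ℝ) ≤ 1 := by
    exact_mod_cast card_extremal_le_one hconn hd hb hon (σ := -1) (by norm_num)
  have := mul_le_mul_of_nonneg_right h1 hK0
  have := mul_le_mul_of_nonneg_right h2 hK0
  linarith

end UMultigraph

/-! ### Entropy lower bound for alternating walks -/

lemma log_card_add_sum_log_le {ι : Type*} {A : Finset ι} (hA : A.Nonempty) {g : ι → ℝ}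
    (hg : ∀ i ∈ A, 0 < g i) :
    Real.log #A + (#A : ℝ)⁻¹ * ∑ i ∈ A, Real.log (g i) ≤ Real.log (∑ i ∈ A, g i) := by
  have hc : (0 : ℝ) < #A := by exact_mod_cast hA.card_pos
  have h := strictConcaveOn_log_Ioi.concaveOn.le_map_sum (t := A) (w := fun _ => (#A : ℝ)⁻¹)
    (p := g) (fun _ _ => by positivity) (by simp [hc.ne']) hg
  simp only [smul_eq_mul] at h
  rw [← mul_sum, ← mul_sum, Real.log_mul (inv_pos.2 hc).ne' (sum_pos hg hA).ne',
    Real.log_inv] at h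
  linarith

section Step

variable {α β : Type*} [DecidableEq α] [DecidableEq β]

/-- Sum of `g` over the other elements of the fibre. -/
def fibreStep (F : Finset α) (φ : α → β) (g : α → ℝ) (e : α) : ℝ :=
  ∑ e' ∈ F with φ e' = φ e ∧ e' ≠ e, g e'

lemma card_fibre_ne (F : Finset α) (φ : α → β) {e : α} (he : e ∈ F) :
    (#{e' ∈ F | φ e' = φ e ∧ e' ≠ e} : ℝ) = #{e' ∈ F | φ e' = φ e} - 1 := by
  have h : {e' ∈ F | φ e' = φ e ∧ e' ≠ e} = ({e' ∈ F | φ e' = φ e} : Finset α).erase e := by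
    ext e'
    simp only [mem_filter, mem_erase]
    tauto
  rw [h, cast_card_erase_of_mem (by simp [he])]

lemma fibre_ne_nonempty {F : Finset α} {φ : α → β} {e : α} (he : e ∈ F)
    (h2 : 2 ≤ #{e' ∈ F | φ e' = φ e}) : ({e' ∈ F | φ e' = φ e ∧ e' ≠ e} : Finset α).Nonempty := by
  rw [← card_pos]
  have h := card_fibre_ne F φ he
  have h2' : (2 : ℝ) ≤ #{e' ∈ F | φ e' = φ e} := by exact_mod_cast h2
  have : (0 : ℝ) < #{e' ∈ F | φ e' = φ e ∧ e' ≠ e} := by linarith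
  exact_mod_cast this

lemma fibreStep_pos {F : Finset α} {φ : α → β} (h2 : ∀ e ∈ F, 2 ≤ #{e' ∈ F | φ e' = φ e})
    {g : α → ℝ} (hg : ∀ e ∈ F, 0 < g e) : ∀ e ∈ F, 0 < fibreStep F φ g e := fun e he =>
  sum_pos (fun e' he' => hg e' (mem_filter.1 he').1) (fibre_ne_nonempty he (h2 e he))

/-- Jensen's inequality in each fibre, then summation over `F`. No term in `g` is lost, because
moving to a uniformly random other element of the fibre preserves the uniform measure. -/
lemma sum_log_fibreStep {F : Finset α} {φ : α → β} (h2 : ∀ e ∈ F, 2 ≤ #{e' ∈ F | φ e' = φ e})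
    {g : α → ℝ} (hg : ∀ e ∈ F, 0 < g e) :
    ∑ e ∈ F, Real.log (#{e' ∈ F | φ e' = φ e} - 1) + ∑ e ∈ F, Real.log (g e)
      ≤ ∑ e ∈ F, Real.log (fibreStep F φ g e) := by
  -- Stationarity: each element is reached from the `k - 1` others in its fibre, each with weight `1
  -- / (k - 1)`.
  have hswap : ∑ e ∈ F, ∑ e' ∈ F with φ e' = φ e ∧ e' ≠ e,
      ((#{e' ∈ F | φ e' = φ e} : ℝ) - 1)⁻¹ * Real.log (g e') = ∑ e ∈ F, Real.log (g e) := by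
    rw [sum_comm' (t' := F) (s' := fun e' => {e ∈ F | φ e = φ e' ∧ e ≠ e'})
      (by intro x y; simp only [mem_filter]; grind)]
    refine sum_congr rfl fun e he => ?_
    rw [sum_congr rfl (g := fun _ => ((#{e' ∈ F | φ e' = φ e} : ℝ) - 1)⁻¹ * Real.log (g e))
      (by intro e' he'; rw [(mem_filter.1 he').2.1]), sum_const, nsmul_eq_mul, card_fibre_ne F φ he]
    have : (2 : ℝ) ≤ #{e' ∈ F | φ e' = φ e} := by exact_mod_cast h2 e he
    have : (#{e' ∈ F | φ e' = φ e} : ℝ) - 1 ≠ 0 := by linarith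
    field_simp
  rw [← hswap, ← sum_add_distrib]
  refine sum_le_sum fun e he => ?_
  have := log_card_add_sum_log_le (fibre_ne_nonempty he (h2 e he)) (g := g)
    fun e' he' => hg e' (mem_filter.1 he').1
  rw [card_fibre_ne F φ he, mul_sum] at this
  exact this

/-- The number of alternating non-backtracking walks with `2 * n + 1` edges, starting with a
given element and a step in the `φ`-fibre. -/
def altCount (F : Finset α) (φ ψ : α → β) : ℕ → α → ℝ
  | 0 => fun _ => 1
  | n + 1 => fibreStep F φ (fibreStep F ψ (altCount F φ ψ n))

lemma altCount_pos {F : Finset α} {φ ψ : α → β} (hφ : ∀ e ∈ F, 2 ≤ #{e' ∈ F | φ e' = φ e})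
    (hψ : ∀ e ∈ F, 2 ≤ #{e' ∈ F | ψ e' = ψ e}) (n : ℕ) : ∀ e ∈ F, 0 < altCount F φ ψ n e := by
  induction n with
  | zero => exact fun _ _ => one_pos
  | succ n ih => exact fibreStep_pos hφ (fibreStep_pos hψ ih)

lemma sum_log_altCount {F : Finset α} {φ ψ : α → β} (hφ : ∀ e ∈ F, 2 ≤ #{e' ∈ F | φ e' = φ e})
    (hψ : ∀ e ∈ F, 2 ≤ #{e' ∈ F | ψ e' = ψ e}) (n : ℕ) :
    n * (∑ e ∈ F, Real.log (#{e' ∈ F | φ e' = φ e} - 1)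
      + ∑ e ∈ F, Real.log (#{e' ∈ F | ψ e' = ψ e} - 1))
      ≤ ∑ e ∈ F, Real.log (altCount F φ ψ n e) := by
  induction n with
  | zero => simp [altCount]
  | succ n ih =>
    have h1 := sum_log_fibreStep hψ (altCount_pos hφ hψ n)
    have h2 := sum_log_fibreStep hφ (fibreStep_pos hψ (altCount_pos hφ hψ n))
    simp only [altCount]
    push_cast
    linarith

lemma sum_log_fibre {F : Finset α} {φ : α → β} {T : Finset β} (hT : ∀ e ∈ F, φ e ∈ T) :
    ∑ e ∈ F, Real.log (#{e' ∈ F | φ e' = φ e} - 1)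
      = ∑ t ∈ T, (#{e ∈ F | φ e = t} : ℝ) * Real.log (#{e ∈ F | φ e = t} - 1) := by
  rw [← sum_fiberwise_of_maps_to hT]
  refine sum_congr rfl fun t _ => ?_
  rw [sum_congr rfl (g := fun _ => Real.log ((#{e ∈ F | φ e = t} : ℝ) - 1))
    (by intro e he; rw [(mem_filter.1 he).2]), sum_const, nsmul_eq_mul]

lemma sum_card_fibre {F : Finset α} {φ : α → β} {T : Finset β} (hT : ∀ e ∈ F, φ e ∈ T) :
    ∑ t ∈ T, (#{e ∈ F | φ e = t} : ℝ) = #F := by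
  exact_mod_cast (card_eq_sum_card_fiberwise hT).symm

end Step

/-! ### Two inequalities for `x * log (x - 1)` -/

/-- The line is the tangent at `2`. The gap `1 / 16` is dictated by `x = 3`, where `3 * log 2 >
2.079`; it is the source of the stability statement. -/
lemma mul_log_sub_one_ge {x : ℕ} (hx : 2 ≤ x) :
    2 * ((x : ℝ) - 2) + (if x = 2 then 0 else 1 / 16) ≤ x * Real.log (x - 1) := by
  have hl := Real.log_two_gt_d9
  obtain rfl | hx := hx.eq_or_lt
  · norm_num
  rw [if_neg (by omega)]
  obtain rfl | hx : x = 3 ∨ 4 ≤ x := by omega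
  · norm_num
    linarith
  have hx' : (4 : ℝ) ≤ x := by exact_mod_cast hx
  have h1 := Real.one_sub_inv_le_log_of_pos (x := ((x : ℝ) - 1) / 4) (by linarith)
  rw [Real.log_div (by linarith) (by norm_num), show (4 : ℝ) = 2 ^ 2 by norm_num,
    Real.log_pow] at h1
  have h2 : 2.386 - 4 / ((x : ℝ) - 1) ≤ Real.log (x - 1) := by
    rw [inv_div] at h1
    norm_num at h1 ⊢
    linarith
  have h3 : x * (2.386 - 4 / ((x : ℝ) - 1)) = 2.386 * x - 4 - 4 / ((x : ℝ) - 1) := by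
    have : (x : ℝ) - 1 ≠ 0 := by linarith
    field_simp
    ring
  have h4 : 4 / ((x : ℝ) - 1) ≤ 4 / 3 := by
    apply div_le_div_of_nonneg_left <;> linarith
  have h5 := mul_le_mul_of_nonneg_left h2 (by linarith : (0 : ℝ) ≤ x)
  rw [h3] at h5
  linarith

/-- The two sides agree at the full degree `x = q + 1`. The slope `3 / 2` is the largest value of `x
/ (x - 1)` for `x ≥ 3`; the case `x = 2` is checked directly. -/
lemma mul_log_sub_one_ge_of_le {q : ℝ} (hq : 2 ≤ q) {x : ℕ} (hx : 2 ≤ x) (hxq : (x : ℝ) ≤ q + 1) :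
    x * Real.log q + 3 / 2 * (x - (q + 1)) ≤ x * Real.log (x - 1) := by
  obtain rfl | hx := hx.eq_or_lt
  · have hl := Real.log_two_lt_d9
    have h1 := Real.log_le_sub_one_of_pos (x := q / 2) (by linarith)
    rw [Real.log_div (by linarith) (by norm_num)] at h1
    norm_num
    linarith
  have hx' : (3 : ℝ) ≤ x := by exact_mod_cast hx
  have h1 := Real.one_sub_inv_le_log_of_pos (x := ((x : ℝ) - 1) / q)
    (div_pos (by linarith) (by linarith))
  rw [Real.log_div (by linarith) (by linarith), inv_div] at h1
  have h2 : x * (1 - q / ((x : ℝ) - 1)) ≤ x * (Real.log (x - 1) - Real.log q) :=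
    mul_le_mul_of_nonneg_left h1 (by linarith)
  have h3 : 3 / 2 * (x - (q + 1)) ≤ x * (1 - q / ((x : ℝ) - 1)) := by
    have h4 : (0 : ℝ) < x - 1 := by linarith
    have h5 : x * (1 - q / ((x : ℝ) - 1)) = x * (x - (q + 1)) / (x - 1) := by
      field_simp
      ring
    rw [h5, le_div_iff₀ h4]
    nlinarith
  linarith

/-! ### The core and the comparison of walk counts -/

namespace UMultigraph

variable {V : Type u} {E : Type v} [Fintype V] [Fintype E] [DecidableEq V] [DecidableEq E]

/-- The directed edges from `S` to `T`. -/
def edgesBetween (G : UMultigraph V E) (S T : Finset V) : Finset E :=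
  univ.filter fun e => G.src e ∈ S ∧ G.tgt e ∈ T

lemma mem_edgesBetween {G : UMultigraph V E} {S T : Finset V} {e : E} :
    e ∈ G.edgesBetween S T ↔ G.src e ∈ S ∧ G.tgt e ∈ T := by
  simp [edgesBetween]

lemma edgesBetween_mono (G : UMultigraph V E) {S S' T T' : Finset V} (hS : S' ⊆ S)
    (hT : T' ⊆ T) : G.edgesBetween S' T' ⊆ G.edgesBetween S T := by
  intro e he
  rw [mem_edgesBetween] at he ⊢
  exact ⟨hS he.1, hT he.2⟩

lemma card_edgesBetween_le (G : UMultigraph V E) {d : ℕ} (hd : G.IsRegular d) (S T : Finset V) :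
    #(G.edgesBetween S T) ≤ d * #S := by
  refine card_le_mul_card_image_of_maps_to (f := G.src) (fun e he => (mem_edgesBetween.1 he).1) d ?_
  intro x _
  rw [← hd x]
  exact card_le_card fun e he => by simpa using (mem_filter.1 he).2

lemma card_edgesBetween_neighbors (G : UMultigraph V E) {d : ℕ} (hd : G.IsRegular d)
    (S : Finset V) : #(G.edgesBetween S (G.neighbors S)) = d * #S := by
  rw [card_eq_sum_card_fiberwise (f := G.src) (t := S) fun e he => (mem_edgesBetween.1 he).1,
    sum_congr rfl (g := fun _ => d), sum_const, smul_eq_mul, mul_comm]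
  intro x hx
  rw [← hd x, degree]
  congr 1
  ext e
  simp only [mem_filter, mem_edgesBetween, mem_univ, true_and, neighbors, mem_image]
  constructor
  · exact fun h => h.2
  · rintro rfl
    exact ⟨⟨hx, e, hx, rfl⟩, rfl⟩

/-- Subsets of `S` and `T` that span a bipartite graph with all degrees at least two, and that
carry most of the edges between `S` and `T` if those have average degree close to two on `T`. -/
lemma exists_core (G : UMultigraph V E) {d : ℕ} (hd3 : 3 ≤ d) (S T : Finset V) :
    ∃ S' T', S' ⊆ S ∧ T' ⊆ T ∧
      (∀ x ∈ S', 2 ≤ #{e ∈ G.edgesBetween S' T' | G.src e = x}) ∧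
      (∀ x ∈ T', 2 ≤ #{e ∈ G.edgesBetween S' T' | G.tgt e = x}) ∧
      3 / 2 * ((#(G.edgesBetween S T) : ℝ) - d * #S) + 2 * (#(G.edgesBetween S T) - 2 * #T)
        + (#(G.edgesBetween S T) + #T) / 8
      ≤ 3 / 2 * ((#(G.edgesBetween S' T') : ℝ) - d * #S') + 2 * (#(G.edgesBetween S' T') - 2 * #T')
        + (#(G.edgesBetween S' T') + #T') / 8 := by
  have hd3' : (3 : ℝ) ≤ d := by exact_mod_cast hd3
  -- An edge weighs `3/2 + 2 + 1/8 = 29/8`. Removing a vertex of `S'` gains `3 * d / 2 ≥ 9/2`, and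
  -- one of `T'` gains `4 - 1/8 = 31/8`. Removing a vertex with at most one edge thus raises `Ψ`,
  -- and a maximizer has none. The `1/8` terms record what was removed, for use in the stability
  -- bound.
  let Ψ : Finset V × Finset V → ℝ := fun p =>
    3 / 2 * ((#(G.edgesBetween p.1 p.2) : ℝ) - d * #p.1) + 2 * (#(G.edgesBetween p.1 p.2) - 2 * #p.2)
        + (#(G.edgesBetween p.1 p.2) + #p.2) / 8
  obtain ⟨⟨S', T'⟩, hp, hmax⟩ := exists_max_image (S.powerset ×ˢ T.powerset) Ψ
    ⟨(S, T), by simp⟩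
  simp only [mem_product, mem_powerset] at hp
  have hdel : ∀ F F' : Finset E, ∀ P : E → Prop, ∀ [DecidablePred P], #{e ∈ F | P e} < 2 →
      (∀ e ∈ F, ¬ P e → e ∈ F') → (#F : ℝ) - 1 ≤ #F' := by
    intro F F' P _ h2 hF
    have h1 : #F ≤ #{e ∈ F | P e} + #F' := by
      rw [← card_filter_add_card_filter_not P]
      gcongr
      intro e he
      exact hF e (mem_filter.1 he).1 (mem_filter.1 he).2
    have h3 : #F ≤ 1 + #F' := by omega
    have : (#F : ℝ) ≤ 1 + #F' := by exact_mod_cast h3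
    linarith
  refine ⟨S', T', hp.1, hp.2, ?_, ?_, hmax (S, T) (by simp)⟩
  · intro x hx
    by_contra! hlt
    have h1 := hmax (S'.erase x, T') (by
      simpa using ⟨(erase_subset x S').trans hp.1, hp.2⟩)
    have h2 := hdel _ (G.edgesBetween (S'.erase x) T') _ hlt fun e he hne => by
      rw [mem_edgesBetween] at he ⊢
      exact ⟨mem_erase.2 ⟨hne, he.1⟩, he.2⟩
    simp only [Ψ] at h1
    rw [cast_card_erase_of_mem hx] at h1
    linarith
  · intro x hx
    by_contra! hlt
    have h1 := hmax (S', T'.erase x) (by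
      simpa using ⟨hp.1, (erase_subset x T').trans hp.2⟩)
    have h2 := hdel _ (G.edgesBetween S' (T'.erase x)) _ hlt fun e he hne => by
      rw [mem_edgesBetween] at he ⊢
      exact ⟨he.1, mem_erase.2 ⟨hne, he.2⟩⟩
    simp only [Ψ] at h1
    rw [cast_card_erase_of_mem hx] at h1
    linarith

lemma fibreStep_tgt_le (G : UMultigraph V E) (F : Finset E) {g u : E → ℝ} (hu : ∀ e, 0 ≤ u e)
    (h : ∀ e ∈ F, g e ≤ u (G.inv e)) (e : E) :
    fibreStep F G.tgt g e ≤ ∑ e' with G.src e' = G.tgt e ∧ e' ≠ G.inv e, u e' := by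
  refine (sum_le_sum fun e' he' => h e' (mem_filter.1 he').1).trans ?_
  rw [← sum_image (f := u) (g := G.inv) fun a _ b _ hab => G.invEquiv.injective hab]
  refine sum_le_sum_of_subset_of_nonneg ?_ fun e' _ _ => hu e'
  intro e' he'
  obtain ⟨a, ha, rfl⟩ := mem_image.1 he'
  obtain ⟨-, h1, h2⟩ := mem_filter.1 ha
  exact mem_filter.2 ⟨mem_univ _, by rw [G.src_inv, h1], fun h => h2 (G.invEquiv.injective h)⟩

lemma fibreStep_src_le (G : UMultigraph V E) (F : Finset E) {g u : E → ℝ} (hu : ∀ e, 0 ≤ u e)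
    (h : ∀ e ∈ F, g e ≤ u e) (e : E) :
    fibreStep F G.src g e
      ≤ ∑ e' with G.src e' = G.tgt (G.inv e) ∧ e' ≠ G.inv (G.inv e), u e' := by
  refine (sum_le_sum fun e' he' => h e' (mem_filter.1 he').1).trans ?_
  refine sum_le_sum_of_subset_of_nonneg ?_ fun e' _ _ => hu e'
  intro e' he'
  obtain ⟨-, h1, h2⟩ := mem_filter.1 he'
  rw [G.tgt_inv, G.inv_inv]
  exact mem_filter.2 ⟨mem_univ _, h1, h2⟩

lemma altCount_le_walkCount (G : UMultigraph V E) (S T : Finset V) (n : ℕ) :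
    ∀ e ∈ G.edgesBetween S T, altCount (G.edgesBetween S T) G.src G.tgt n e
      ≤ G.walkCount (fun x => if x ∈ S then 1 else 0) (2 * n) (G.inv e) := by
  have h0 := G.walkCount_nonneg (f := fun x => if x ∈ S then 1 else 0)
    fun x => by split_ifs <;> norm_num
  induction n with
  | zero =>
    intro e he
    simp [altCount, walkCount, G.tgt_inv, (mem_edgesBetween.1 he).1]
  | succ n ih =>
    intro e _
    exact G.fibreStep_src_le _ (h0 (2 * n + 1))
      (fun e' _ => G.fibreStep_tgt_le _ (h0 (2 * n)) ih e') e

/-- The number of non-backtracking walks between `S` and `T` is bounded by the number of such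
walks in the whole graph. -/
lemma sum_fibreStep_altCount_le (G : UMultigraph V E) (S T : Finset V) (n : ℕ) :
    ∑ e ∈ G.edgesBetween S T, fibreStep (G.edgesBetween S T) G.tgt
        (altCount (G.edgesBetween S T) G.src G.tgt n) e
      ≤ ∑ x ∈ S, G.sphereSum (fun x => if x ∈ S then 1 else 0) (2 * n + 1) x := by
  have h0 := G.walkCount_nonneg (f := fun x => if x ∈ S then 1 else 0)
    fun x => by split_ifs <;> norm_num
  calc _ ≤ ∑ e ∈ G.edgesBetween S T,
        G.walkCount (fun x => if x ∈ S then 1 else 0) (2 * n + 1) e :=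
        sum_le_sum fun e _ =>
          G.fibreStep_tgt_le _ (h0 (2 * n)) (G.altCount_le_walkCount S T n) e
    _ ≤ ∑ e with G.src e ∈ S, G.walkCount (fun x => if x ∈ S then 1 else 0) (2 * n + 1) e :=
        sum_le_sum_of_subset_of_nonneg
          (fun e he => mem_filter.2 ⟨mem_univ _, (mem_edgesBetween.1 he).1⟩) fun e _ _ => h0 _ e
    _ = _ := by
        rw [← sum_fiberwise_of_maps_to (t := S) (g := G.src) fun e he => (mem_filter.1 he).2]
        refine sum_congr rfl fun x hx => ?_
        rw [sphereSum, filter_filter]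
        refine sum_congr ?_ fun _ _ => rfl
        ext e
        simp only [mem_filter, mem_univ, true_and]
        exact ⟨fun h => h.2, fun h => ⟨h ▸ hx, h⟩⟩

/-- Comparison of the lower and the upper bound for the number of non-backtracking walks. -/
lemma IsRamanujan.core_inequality {G : UMultigraph V E} {d : ℕ} (hG : G.IsRamanujan d) {q : ℝ}
    (hq : 2 ≤ q) (hdq : (d : ℝ) = q + 1) {S T : Finset V} {l : ℕ} (hl : 1 ≤ l)
    (hS : (#S : ℝ) * q ^ l ≤ Fintype.card V)
    (hSdeg : ∀ x ∈ S, 2 ≤ #{e ∈ G.edgesBetween S T | G.src e = x})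
    (hTdeg : ∀ x ∈ T, 2 ≤ #{e ∈ G.edgesBetween S T | G.tgt e = x}) :
    l * (3 / 2 * ((#(G.edgesBetween S T) : ℝ) - d * #S)
        + ∑ x ∈ T, (#{e ∈ G.edgesBetween S T | G.tgt e = x} : ℝ)
          * Real.log (#{e ∈ G.edgesBetween S T | G.tgt e = x} - 1))
      ≤ #(G.edgesBetween S T) * Real.log (3 * l + 5) := by
  have hd := hG.2.1
  have hV : (0 : ℝ) < Fintype.card V := by
    have := hG.1.1
    exact_mod_cast Fintype.card_pos
  have hUp := fun n => (G.sum_fibreStep_altCount_le S T n).trans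
    (hG.sum_sphereSum_le (by linarith) hdq S (2 * n + 1))
  have hmle : (#(G.edgesBetween S T) : ℝ) ≤ d * #S := by
    exact_mod_cast G.card_edgesBetween_le hd S T
  have hsrc : ∀ e ∈ G.edgesBetween S T, G.src e ∈ S := fun e he => (mem_edgesBetween.1 he).1
  have htgt : ∀ e ∈ G.edgesBetween S T, G.tgt e ∈ T := fun e he => (mem_edgesBetween.1 he).2
  have hdegle : ∀ x, (#{e ∈ G.edgesBetween S T | G.src e = x} : ℝ) ≤ q + 1 := by
    intro x
    rw [← hdq, ← hd x]
    exact_mod_cast card_le_card fun e he => by simpa using (mem_filter.1 he).2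
  generalize G.edgesBetween S T = F at *
  rcases S.eq_empty_or_nonempty with rfl | hSne
  · have hF : F = ∅ := eq_empty_of_forall_notMem fun e he => by simpa using hsrc e he
    subst hF
    simp
  obtain ⟨x₀, hx₀⟩ := hSne
  have hFne : F.Nonempty := by
    have := hSdeg x₀ hx₀
    obtain ⟨e, he⟩ := card_pos.1 (by omega : 0 < #{e ∈ F | G.src e = x₀})
    exact ⟨e, (mem_filter.1 he).1⟩
  have hs : (0 : ℝ) < #S := by exact_mod_cast card_pos.2 ⟨x₀, hx₀⟩
  have hm : (0 : ℝ) < #F := by exact_mod_cast card_pos.2 hFne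
  have hS2 : ∀ e ∈ F, 2 ≤ #{e' ∈ F | G.src e' = G.src e} := fun e he => hSdeg _ (hsrc e he)
  have hT2 : ∀ e ∈ F, 2 ≤ #{e' ∈ F | G.tgt e' = G.tgt e} := fun e he => hTdeg _ (htgt e he)
  obtain ⟨n, rfl⟩ : ∃ n, l = n + 1 := ⟨l - 1, by omega⟩
  have hpos := altCount_pos hS2 hT2 n
  have hlow1 := sum_log_altCount hS2 hT2 n
  have hlow2 := sum_log_fibreStep hT2 hpos
  have hlow3 := log_card_add_sum_log_le hFne (fibreStep_pos hT2 hpos)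
  have hWpos := sum_pos (fibreStep_pos hT2 hpos) hFne
  rw [sum_log_fibre hsrc, sum_log_fibre htgt] at hlow1
  rw [sum_log_fibre htgt] at hlow2
  -- These walks have `2 * (n + 1) = 2 * l` edges. The bound `(q + 1) / q ≤ 3 / 2` turns the
  -- spectral estimate into `3/2 * (2 * l + 1) + 3 ≤ 3 * l + 5`.
  have hW : ∑ e ∈ F, fibreStep F G.tgt (altCount F G.src G.tgt n) e
      ≤ #S * (q ^ (n + 1) * (3 * ((n + 1 : ℕ) : ℝ) + 5)) := by
    refine (hUp n).trans ?_
    have h1 : √q ^ (2 * n + 1 + 1) = q ^ (n + 1) := by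
      rw [show 2 * n + 1 + 1 = 2 * (n + 1) by ring, pow_mul, Real.sq_sqrt (by linarith)]
    have h2 : (q + 1) / q ≤ 3 / 2 := by
      rw [div_le_div_iff₀ (by linarith) (by norm_num)]
      linarith
    have h3 : q ^ (2 * n + 1 + 1) * ((#S : ℝ) ^ 2 / Fintype.card V) ≤ #S * q ^ (n + 1) := by
      rw [show 2 * n + 1 + 1 = (n + 1) + (n + 1) by ring, pow_add, mul_div_assoc', div_le_iff₀ hV]
      have := mul_le_mul_of_nonneg_left hS (by positivity : 0 ≤ #S * q ^ (n + 1))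
      linarith
    have h0 : 0 ≤ q ^ (n + 1) := by positivity
    rw [h1, mul_assoc ((q + 1) / q) (q ^ _)]
    have h4 : (q + 1) / q * (((2 * n + 1 : ℕ) : ℝ) + 2) * q ^ (n + 1) * #S
        ≤ 3 / 2 * (((2 * n + 1 : ℕ) : ℝ) + 2) * q ^ (n + 1) * #S := by gcongr
    have h5 : (q + 1) / q * (q ^ (2 * n + 1 + 1) * ((#S : ℝ) ^ 2 / Fintype.card V))
        ≤ 3 / 2 * (#S * q ^ (n + 1)) := by gcongr
    have h6 : 0 ≤ #S * q ^ (n + 1) := by positivity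
    push_cast at h4 ⊢
    linarith
  have hlogW := Real.log_le_log hWpos hW
  rw [Real.log_mul hs.ne' (by positivity), Real.log_mul (by positivity) (by positivity),
    Real.log_pow] at hlogW
  have hMS : #F * Real.log q + 3 / 2 * (#F - d * #S)
      ≤ ∑ x ∈ S, (#{e ∈ F | G.src e = x} : ℝ) * Real.log (#{e ∈ F | G.src e = x} - 1) := by
    calc _ = ∑ x ∈ S, ((#{e ∈ F | G.src e = x} : ℝ) * Real.log q
          + 3 / 2 * (#{e ∈ F | G.src e = x} - (q + 1))) := by
          rw [sum_add_distrib, ← sum_mul, ← mul_sum, sum_sub_distrib, sum_card_fibre hsrc,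
            sum_const, nsmul_eq_mul, hdq]
          ring
      _ ≤ _ := sum_le_sum fun x hx => mul_log_sub_one_ge_of_le hq (hSdeg x hx) (hdegle x)
  -- There are `l` steps at `T` but only `l - 1` at `S`; the choice of the initial edge, `log #F -
  -- log #S`, replaces the missing one.
  have hinit : #F * Real.log q + 3 / 2 * (#F - d * #S)
      ≤ #F * (Real.log #F - Real.log #S) := by
    have hdpos : (0 : ℝ) < d := by linarith
    have h1 := Real.one_sub_inv_le_log_of_pos (x := (#F : ℝ) / (d * #S)) (by positivity)
    rw [Real.log_div hm.ne' (by positivity), Real.log_mul hdpos.ne' hs.ne', inv_div] at h1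
    have h2 : Real.log q ≤ Real.log d := Real.log_le_log (by linarith) (by linarith)
    have h3 := mul_le_mul_of_nonneg_left h1 hm.le
    have h4 : (#F : ℝ) * (1 - d * #S / #F) = #F - d * #S := by field_simp
    rw [h4] at h3
    have h5 := mul_le_mul_of_nonneg_left h2 hm.le
    linarith
  have hfin := mul_le_mul_of_nonneg_left (hlow3.trans hlogW) hm.le
  rw [mul_add, ← mul_assoc, mul_inv_cancel₀ hm.ne', one_mul] at hfin
  have hMS' := mul_le_mul_of_nonneg_left hMS (Nat.cast_nonneg (α := ℝ) n)
  push_cast at hfin ⊢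
  linarith

end UMultigraph

/-! ### Expansion with stability, and small degrees -/

namespace UMultigraph

variable {V : Type u} {E : Type v} [Fintype V] [Fintype E] [DecidableEq V] [DecidableEq E]

/-- A vertex of `N(S)` that stays in the core, loses no edge and has core degree `2` is good. So a
bad one was removed, has another core degree, or is the target of a removed edge. -/
lemma card_filter_edgesFrom_ne_two_le (G : UMultigraph V E) {S S' T' : Finset V} (hS : S' ⊆ S)
    (hT : T' ⊆ G.neighbors S) :
    (#{x ∈ G.neighbors S | G.edgesFrom S x ≠ 2} : ℝ)
      ≤ ((#(G.neighbors S) : ℝ) - #T')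
        + #{x ∈ T' | #{e ∈ G.edgesBetween S' T' | G.tgt e = x} ≠ 2}
        + (#(G.edgesBetween S (G.neighbors S)) - #(G.edgesBetween S' T')) := by
  have hF := G.edgesBetween_mono hS hT
  have hsub : ({x ∈ G.neighbors S | G.edgesFrom S x ≠ 2} : Finset V)
      ⊆ (G.neighbors S \ T' ∪ {x ∈ T' | #{e ∈ G.edgesBetween S' T' | G.tgt e = x} ≠ 2})
        ∪ (G.edgesBetween S (G.neighbors S) \ G.edgesBetween S' T').image G.tgt := by
    intro x hx
    obtain ⟨hxN, hx2⟩ := mem_filter.1 hx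
    by_contra hcon
    simp only [mem_union, mem_sdiff, mem_filter, not_or, not_and, not_not, hxN, true_imp_iff]
      at hcon
    obtain ⟨⟨hxT, hc⟩, him⟩ := hcon
    apply hx2
    rw [← hc hxT, edgesFrom]
    congr 1
    ext e
    simp only [mem_filter, mem_univ, true_and]
    constructor
    · rintro ⟨h1, rfl⟩
      refine ⟨?_, rfl⟩
      by_contra hne
      exact him (mem_image_of_mem _ (mem_sdiff.2 ⟨mem_edgesBetween.2 ⟨h1, hxN⟩, hne⟩))
    · rintro ⟨h1, h2⟩
      exact ⟨hS (mem_edgesBetween.1 h1).1, h2⟩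
  have h1 := (card_le_card hsub).trans ((card_union_le _ _).trans
    (add_le_add (card_union_le _ _) card_image_le))
  rw [← cast_card_sdiff hT, ← cast_card_sdiff hF]
  exact_mod_cast h1

/-- Vertex expansion of small sets in Ramanujan graphs, with a stability term. -/
lemma IsRamanujan.expansion {G : UMultigraph V E} {d : ℕ} (hG : G.IsRamanujan d) (hd3 : 3 ≤ d)
    {S : Finset V} {l : ℕ} (hl : 1 ≤ l)
    (hS : (#S : ℝ) * ((d : ℝ) - 1) ^ l ≤ Fintype.card V) :
    2 * (d * #S - 2 * (#(G.neighbors S) : ℝ))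
        + (#{x ∈ G.neighbors S | G.edgesFrom S x ≠ 2} : ℝ) / 16
      ≤ d * #S * (Real.log (3 * l + 5) / l) := by
  have hd3' : (3 : ℝ) ≤ d := by exact_mod_cast hd3
  obtain ⟨S', T', hS', hT', hSdeg, hTdeg, hΨ⟩ := G.exists_core hd3 S (G.neighbors S)
  have hm : (#(G.edgesBetween S (G.neighbors S)) : ℝ) = d * #S := by
    exact_mod_cast G.card_edgesBetween_neighbors hG.2.1 S
  have hbad := G.card_filter_edgesFrom_ne_two_le hS' hT'
  have hmm : (#(G.edgesBetween S' T') : ℝ) ≤ #(G.edgesBetween S (G.neighbors S)) := by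
    exact_mod_cast card_le_card (G.edgesBetween_mono hS' hT')
  have htt : (#T' : ℝ) ≤ #(G.neighbors S) := by exact_mod_cast card_le_card hT'
  have hss : (#S' : ℝ) ≤ #S := by exact_mod_cast card_le_card hS'
  have hcore := hG.core_inequality (q := (d : ℝ) - 1) (by linarith) (by ring) hl
    ((mul_le_mul_of_nonneg_right hss (pow_nonneg (by linarith) l)).trans hS) hSdeg hTdeg
  have hMT : 2 * ((#(G.edgesBetween S' T') : ℝ) - 2 * #T')
      + (#{x ∈ T' | #{e ∈ G.edgesBetween S' T' | G.tgt e = x} ≠ 2} : ℝ) / 16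
      ≤ ∑ x ∈ T', (#{e ∈ G.edgesBetween S' T' | G.tgt e = x} : ℝ)
          * Real.log (#{e ∈ G.edgesBetween S' T' | G.tgt e = x} - 1) := by
    calc _ = ∑ x ∈ T', (2 * ((#{e ∈ G.edgesBetween S' T' | G.tgt e = x} : ℝ) - 2)
          + if #{e ∈ G.edgesBetween S' T' | G.tgt e = x} = 2 then 0 else 1 / 16) := by
          rw [sum_add_distrib, ← mul_sum, sum_sub_distrib,
            sum_card_fibre fun e he => (mem_edgesBetween.1 he).2, sum_ite, sum_const_zero,
            sum_const, sum_const, nsmul_eq_mul, nsmul_eq_mul]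
          ring
      _ ≤ _ := sum_le_sum fun x hx => mul_log_sub_one_ge (hTdeg x hx)
  have hl' : (0 : ℝ) < l := by exact_mod_cast hl
  rw [mul_comm, ← le_div_iff₀ hl', mul_div_assoc] at hcore
  have hlog : 0 ≤ Real.log (3 * l + 5) / l :=
    div_nonneg (Real.log_nonneg (by linarith)) hl'.le
  have hmul := mul_le_mul_of_nonneg_right hmm hlog
  rw [hm] at hΨ hbad hmm hmul
  linarith

lemma edgesFrom_le (G : UMultigraph V E) {d : ℕ} (hd : G.IsRegular d) (S : Finset V) (x : V) :
    G.edgesFrom S x ≤ d := by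
  rw [← hd x, edgesFrom, degree, ← card_image_of_injective _ G.invEquiv.injective]
  refine card_le_card fun e he => ?_
  obtain ⟨a, ha, rfl⟩ := mem_image.1 he
  simp only [mem_filter, mem_univ, true_and] at ha ⊢
  exact (G.src_inv a).trans ha.2

lemma sum_edgesFrom (G : UMultigraph V E) {d : ℕ} (hd : G.IsRegular d) (S : Finset V) :
    ∑ x ∈ G.neighbors S, G.edgesFrom S x = d * #S := by
  rw [← G.card_edgesBetween_neighbors hd, card_eq_sum_card_fiberwise (f := G.tgt)
    (t := G.neighbors S) fun e he => (mem_edgesBetween.1 he).2]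
  refine sum_congr rfl fun x hx => ?_
  rw [edgesFrom]
  congr 1
  ext e
  simp only [mem_filter, mem_univ, true_and, mem_edgesBetween]
  constructor
  · rintro ⟨h1, rfl⟩
    exact ⟨⟨h1, hx⟩, rfl⟩
  · rintro ⟨h1, h2⟩
    exact ⟨h1.1, h2⟩

lemma edgesFrom_pos (G : UMultigraph V E) {S : Finset V} {x : V} (hx : x ∈ G.neighbors S) :
    0 < G.edgesFrom S x := by
  obtain ⟨e, he, rfl⟩ := mem_image.1 hx
  exact card_pos.2 ⟨e, mem_filter.2 ⟨mem_univ _, (mem_filter.1 he).2, rfl⟩⟩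

lemma mul_card_le_mul_card_neighbors (G : UMultigraph V E) {d : ℕ} (hd : G.IsRegular d)
    (S : Finset V) : d * #S ≤ d * #(G.neighbors S) := by
  rw [← G.sum_edgesFrom hd, mul_comm, ← smul_eq_mul]
  exact sum_le_card_nsmul _ _ _ fun x _ => G.edgesFrom_le hd S x

lemma neighborsIn_eq_edgesFrom (G : UMultigraph V E) (hG : G.IsSimple) (S : Finset V) (x : V) :
    G.neighborsIn S x = G.edgesFrom S x := by
  classical
  have h : (S.filter fun y => G.Adj y x)
      = (univ.filter fun e => G.src e ∈ S ∧ G.tgt e = x).image G.src := by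
    ext y
    simp only [mem_filter, mem_image, mem_univ, true_and]
    constructor
    · rintro ⟨hy, e, rfl, h⟩
      exact ⟨e, ⟨hy, h⟩, rfl⟩
    · rintro ⟨e, ⟨hy, h⟩, rfl⟩
      exact ⟨hy, e, rfl, h⟩
  rw [neighborsIn, edgesFrom]
  convert card_image_of_injOn (s := univ.filter fun e => G.src e ∈ S ∧ G.tgt e = x) (f := G.src) ?_
  intro e he e' he' hee
  simp only [coe_filter, mem_univ, true_and, Set.mem_ofPred_eq] at he he'
  exact hG e e' hee (he.2.trans he'.2.symm)

lemma neighbors_eq_empty_of_regular_zero (G : UMultigraph V E) (hd : G.IsRegular 0)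
    (S : Finset V) : G.neighbors S = ∅ := by
  refine eq_empty_of_forall_notMem fun x hx => ?_
  have h1 := G.edgesFrom_pos hx
  have h2 := G.edgesFrom_le hd S x
  omega

/-- The graphs of degree at most two. -/
lemma card_filter_edgesFrom_ne_two_le_of_regular (G : UMultigraph V E) {d : ℕ} (hd2 : d ≤ 2)
    (hd : G.IsRegular d) {δ : ℝ} (hδ : 0 ≤ δ) (hδ1 : δ < 1) (S : Finset V)
    (hN : (#(G.neighbors S) : ℝ) ≤ (d : ℝ) / 2 * #S * (1 + δ)) :
    (#{x ∈ G.neighbors S | G.edgesFrom S x ≠ 2} : ℝ) ≤ 2 * δ * #(G.neighbors S) := by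
  have hN1 : (d : ℝ) * #S ≤ d * #(G.neighbors S) := by
    exact_mod_cast G.mul_card_le_mul_card_neighbors hd S
  have hsum : ∑ x ∈ G.neighbors S, (G.edgesFrom S x : ℝ) = d * #S := by
    exact_mod_cast G.sum_edgesFrom hd S
  interval_cases d
  · simp [G.neighbors_eq_empty_of_regular_zero hd]
  · have hS : (#(G.neighbors S) : ℝ) = 0 := by
      have h0 : (0 : ℝ) ≤ #S := by positivity
      have h1 : (0 : ℝ) ≤ #(G.neighbors S) := by positivity
      rw [Nat.cast_one, one_mul, one_mul] at hN1
      rw [Nat.cast_one] at hN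
      nlinarith [mul_le_mul_of_nonneg_right hN1 (by linarith : 0 ≤ 1 + δ)]
    have hS' : G.neighbors S = ∅ := by
      rw [← card_eq_zero]
      exact_mod_cast hS
    simp [hS']
  -- For `d = 2` the values of `edgesFrom` on `N(S)` are `1` and `2`, so the total deficit from `2`
  -- counts the bad vertices.
  · have h1 : ∑ x ∈ G.neighbors S, ((2 : ℝ) - G.edgesFrom S x)
        = 2 * #(G.neighbors S) - 2 * #S := by
      rw [sum_sub_distrib, hsum, sum_const, nsmul_eq_mul]
      push_cast
      ring
    have h2 : (#{x ∈ G.neighbors S | G.edgesFrom S x ≠ 2} : ℝ)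
        ≤ ∑ x ∈ G.neighbors S, ((2 : ℝ) - G.edgesFrom S x) := by
      rw [card_filter]
      push_cast
      refine sum_le_sum fun x hx => ?_
      have h3 := G.edgesFrom_pos hx
      have h4 := G.edgesFrom_le hd S x
      interval_cases h : G.edgesFrom S x <;> norm_num
    rw [Nat.cast_ofNat] at hN hN1
    nlinarith [mul_le_mul_of_nonneg_right hN1 hδ]

end UMultigraph

/-! ### Choice of constants and conclusion -/

lemma log_three_mul_add_five_le (l : ℕ) :
    Real.log (3 * l + 5) ≤ 3 * Real.log (l + 2) := by
  have h : (3 : ℝ) * l + 5 ≤ (l + 2) ^ 3 := by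
    have : (0 : ℝ) ≤ l := by positivity
    nlinarith [pow_nonneg this 3, pow_nonneg this 2]
  have := Real.log_le_log (by positivity) h
  rwa [Real.log_pow] at this

lemma exists_log_div_le {ε : ℝ} (hε : 0 < ε) :
    ∃ l : ℕ, 1 ≤ l ∧ Real.log (3 * l + 5) / l ≤ ε := by
  have h1 : Filter.Tendsto (fun l : ℕ => Real.log (3 * l + 5) / (1 * (3 * (l : ℝ) + 5) + -5))
      Filter.atTop (nhds 0) := by
    have h := Real.tendsto_pow_log_div_mul_add_atTop 1 (-5) 1 one_ne_zero
    have h2 : Filter.Tendsto (fun l : ℕ => 3 * (l : ℝ) + 5) Filter.atTop Filter.atTop :=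
      Filter.tendsto_atTop_add_const_right _ _
        (tendsto_natCast_atTop_atTop.const_mul_atTop (by norm_num))
    simp only [pow_one] at h
    exact h.comp h2
  have h2 := (h1.eventually (gt_mem_nhds (by positivity : 0 < ε / 3))).and
    (Filter.eventually_ge_atTop 1)
  obtain ⟨l, hl, hl1⟩ := h2.exists
  refine ⟨l, hl1, ?_⟩
  have hl' : (0 : ℝ) < l := by exact_mod_cast hl1
  rw [show 1 * (3 * (l : ℝ) + 5) + -5 = l * 3 by ring, ← div_div,
    div_lt_div_iff_of_pos_right (by norm_num)] at hl
  exact hl.le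

theorem mainTheorem8 :
    (∃ C : ℝ, 0 < C ∧
      ∀ (V : Type u) (E : Type v) [Fintype V] [Fintype E] [DecidableEq V]
        (G : UMultigraph V E) (d : ℕ), G.IsRamanujan d →
      ∀ (S : Finset V) (l : ℕ), 1 ≤ l →
        (S.card : ℝ) * ((d : ℝ) - 1) ^ l ≤ (Fintype.card V : ℝ) →
        (d : ℝ) / 2 * (S.card : ℝ) * (1 - C * (Real.log ((l : ℝ) + 2) / (l : ℝ)))
          ≤ ((G.neighbors S).card : ℝ)) ∧
    (∀ ε : ℝ, 0 < ε → ∃ δ : ℝ, 0 < δ ∧ ∀ d : ℕ, ∃ η : ℝ, 0 < η ∧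
      ∀ (V : Type u) (E : Type v) [Fintype V] [Fintype E] [DecidableEq V]
        (G : UMultigraph V E), G.IsRamanujan d →
      ∀ S : Finset V, (S.card : ℝ) ≤ η * (Fintype.card V : ℝ) →
        ((G.neighbors S).card : ℝ) ≤ (d : ℝ) / 2 * (S.card : ℝ) * (1 + δ) →
        ((((G.neighbors S).filter fun x => G.edgesFrom S x ≠ 2).card : ℝ)
            ≤ ε * ((G.neighbors S).card : ℝ)) ∧
        (G.IsSimple →
          (((G.neighbors S).filter fun x => G.neighborsIn S x ≠ 2).card : ℝ)
            ≤ ε * ((G.neighbors S).card : ℝ))) := by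

  classical
  -- `log (3 * l + 5) ≤ 3 * log (l + 2)`, and the expansion inequality carries a factor `2` on the
  -- left: hence `3 / 2`.
  refine ⟨⟨3 / 2, by norm_num, ?_⟩, ?_⟩
  · intro V E _ _ _ G d hG S l hl hS
    have hl' : (0 : ℝ) < l := by exact_mod_cast hl
    have hlog : 0 ≤ Real.log ((l : ℝ) + 2) / l :=
      div_nonneg (Real.log_nonneg (by linarith)) hl'.le
    have hdS : (0 : ℝ) ≤ d * #S := by positivity
    obtain hd3 | hd3 := le_or_gt 3 d
    · have h1 := hG.expansion hd3 hl hS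
      have h2 : Real.log (3 * (l : ℝ) + 5) / l ≤ 3 * (Real.log ((l : ℝ) + 2) / l) := by
        rw [mul_div_assoc']
        exact div_le_div_of_nonneg_right (log_three_mul_add_five_le l) hl'.le
      have h3 := mul_le_mul_of_nonneg_left h2 hdS
      have h4 : (0 : ℝ) ≤ #{x ∈ G.neighbors S | G.edgesFrom S x ≠ 2} := by positivity
      linarith
    · have h1 : (d : ℝ) * #S ≤ d * #(G.neighbors S) := by
        exact_mod_cast G.mul_card_le_mul_card_neighbors hG.2.1 S
      have h2 : (d : ℝ) ≤ 2 := by exact_mod_cast Nat.le_of_lt_succ hd3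
      have h3 := mul_le_mul_of_nonneg_right h2 (Nat.cast_nonneg (α := ℝ) #(G.neighbors S))
      have h4 := mul_nonneg hdS hlog
      linarith
  · intro ε hε
    -- The bad vertices number at most `16 * 3 * δ * d * #S`, and `d * #S ≤ 4 * #N(S)` once `δ ≤ 1 /
    -- 2`. This gives `192 * δ * #N(S)`, which `200` absorbs. The length `l` depends on `δ` alone;
    -- only `η = (d - 1) ^ (-l)` involves `d`.
    have hmin : 0 < min (1 / 2) (ε / 200) := by positivity
    obtain ⟨δ, hδ, hδ2, hδε⟩ : ∃ δ : ℝ, 0 < δ ∧ δ ≤ 1 / 2 ∧ δ ≤ ε / 200 :=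
      ⟨_, hmin, min_le_left _ _, min_le_right _ _⟩
    obtain ⟨l, hl, hlδ⟩ := exists_log_div_le hδ
    refine ⟨δ, hδ, fun d => ?_⟩
    have key : ∃ η : ℝ, 0 < η ∧
        ∀ (V : Type u) (E : Type v) [Fintype V] [Fintype E] [DecidableEq V]
          (G : UMultigraph V E), G.IsRamanujan d →
        ∀ S : Finset V, (S.card : ℝ) ≤ η * (Fintype.card V : ℝ) →
          ((G.neighbors S).card : ℝ) ≤ (d : ℝ) / 2 * (S.card : ℝ) * (1 + δ) →
          (#{x ∈ G.neighbors S | G.edgesFrom S x ≠ 2} : ℝ) ≤ ε * #(G.neighbors S) := by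
      obtain hd3 | hd3 := le_or_gt 3 d
      · have hd3' : (3 : ℝ) ≤ d := by exact_mod_cast hd3
        have hqpos : 0 < ((d : ℝ) - 1) ^ l := pow_pos (by linarith) l
        refine ⟨(((d : ℝ) - 1) ^ l)⁻¹, inv_pos.2 hqpos, ?_⟩
        intro V E _ _ _ G hG S hS hN
        rw [← div_eq_inv_mul, le_div_iff₀ hqpos] at hS
        have h1 := hG.expansion hd3 hl hS
        have hdS : (0 : ℝ) ≤ d * #S := by positivity
        have h2 := mul_le_mul_of_nonneg_left hlδ hdS
        have h3 := mul_le_mul_of_nonneg_left hδ2 hdS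
        have h4 : (0 : ℝ) ≤ #{x ∈ G.neighbors S | G.edgesFrom S x ≠ 2} := by positivity
        have h5 : d * #S ≤ 4 * (#(G.neighbors S) : ℝ) := by linarith
        have h6 := mul_le_mul_of_nonneg_right h5 hδ.le
        have h7 := mul_le_mul_of_nonneg_right hδε (Nat.cast_nonneg (α := ℝ) #(G.neighbors S))
        linarith
      · refine ⟨1, one_pos, ?_⟩
        intro V E _ _ _ G hG S _ hN
        refine (G.card_filter_edgesFrom_ne_two_le_of_regular (Nat.le_of_lt_succ hd3) hG.2.1 hδ.le
          (by linarith) S hN).trans ?_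
        gcongr
        linarith
    obtain ⟨η, hη, h⟩ := key
    refine ⟨η, hη, fun V E _ _ _ G hG S hS hN => ⟨h V E G hG S hS hN, fun hsimp => ?_⟩⟩
    simp_rw [G.neighborsIn_eq_edgesFrom hsimp]
    exact h V E G hG S hS hN
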